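/- Let $\mathbb{D}=\{z\in\mathbb{C}:|z|<1\}$ and let $E=\{\zeta_1,\dots,\zeta_N\}$, $N\ge 1$, be a finite subset of the unit circle $\{|z|=1\}$. Let $q\ge 0$ and $\varepsilon>0$. Then there is a constant $C=C(\varepsilon,q,E)>0$ such that the following holds for every real number $D$. Let $f$ be an analytic function on $\mathbb{D}$ with $|f(0)|=1$ and $$|f(z)|\le \exp\Bigl(\frac{D}{\operatorname{dist}(z,E)^q}\Bigr)\qquad\text{for all } z\in\mathbb{D}.$$ Then, with $Z_f$ the set of zeros of $f$ in $\mathbb{D}$, each zero being counted in the sum according to its multiplicity, $$\sum_{z\in Z_f}(1-|z|)\operatorname{dist}(z,E)^{(q-1+\varepsilon)_+}\le C(\varepsilon,q,E)\,D,$$ where $x_+=\max\{x,0\}$; in particular the series converges. -/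

import Mathlib

/-- The zero set `Z_f` of `f` in the open unit disk. -/
def diskZeros (f : ℂ → ℂ) : Set ℂ :=
  {z | z ∈ Metric.ball (0 : ℂ) 1 ∧ f z = 0}

open Complex Metric Set Filter Topology ComplexConjugate

/-! For each scale `t`, cut small neighbourhoods of `E` out of the disk and run a Blaschke argument
on what remains. The domain is `{|F| < 1}`, where `F = z exp(s h)`, `h` is the sum of the kernels
`(ζ + z) / (ζ - z)` and `s ~ t²`. It stays at distance `≳ t` from `E`, and `|F a| ≤ exp(-(1 - |a|) /
2)` at points `a` at distance `≥ t`. No general Riemann map is needed: `F z = w` is the fixed-point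
equation `z = w exp(-s h z)`, and Schwarz–Pick makes `F` injective with `F' ≠ 0`
(`dslope_barrierMap_ne_zero`).

On this domain `dist^(-q) ≲ t^(γ - q) dist^(-γ)`, and for `γ < 1` the function `dist^(-γ)` is
dominated by the real part of an analytic function. Multiplying `f` by an exponential makes it
bounded by one, and `norm_apply_zero_le_prod` gives mass `≲ D t^(γ - q)` for the zeros at distance
`≥ t` (`exists_sum_far_zeros_le`). For `q < 1` take `γ = q`; for `q ≥ 1` take `γ` just below 1 and
sum over dyadic layers (`sum_mul_rpow_le`). -/

/-! ### Pseudo-hyperbolic contraction and fixed points. -/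

lemma norm_one_sub_conj_mul_sq_sub (a u : ℂ) :
    ‖1 - conj a * u‖ ^ 2 - ‖a - u‖ ^ 2 = (1 - ‖a‖ ^ 2) * (1 - ‖u‖ ^ 2) := by
  simp only [← normSq_eq_norm_sq, normSq_apply, sub_re, sub_im, mul_re, mul_im, conj_re, conj_im,
    one_re, one_im]
  ring

lemma one_sub_norm_le_norm_one_sub_conj_mul {a u : ℂ} (hu : ‖u‖ ≤ 1) :
    1 - ‖a‖ ≤ ‖1 - conj a * u‖ := by
  have h := norm_sub_norm_le (1 : ℂ) (conj a * u)
  rw [norm_mul, norm_one, Complex.norm_conj] at h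
  nlinarith [norm_nonneg a, norm_nonneg u]

lemma one_sub_conj_mul_ne_zero {a u : ℂ} (ha : ‖a‖ < 1) (hu : ‖u‖ ≤ 1) :
    1 - conj a * u ≠ 0 := by
  rw [← norm_pos_iff]
  linarith [one_sub_norm_le_norm_one_sub_conj_mul (a := a) hu]

/-- The involution of the unit disk exchanging `a` and `0`. -/
noncomputable def diskInvolution (a u : ℂ) : ℂ := (a - u) / (1 - conj a * u)

lemma one_sub_norm_diskInvolution_sq {a u : ℂ} (ha : ‖a‖ < 1) (hu : ‖u‖ ≤ 1) :
    1 - ‖diskInvolution a u‖ ^ 2 =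
      (1 - ‖a‖ ^ 2) * (1 - ‖u‖ ^ 2) / ‖1 - conj a * u‖ ^ 2 := by
  have h : ‖1 - conj a * u‖ ≠ 0 := norm_ne_zero_iff.2 (one_sub_conj_mul_ne_zero ha hu)
  rw [← norm_one_sub_conj_mul_sq_sub, diskInvolution, norm_div,
    eq_div_iff (pow_ne_zero 2 h), sub_mul, div_pow, div_mul_cancel₀ _ (pow_ne_zero 2 h), one_mul]

lemma norm_diskInvolution_lt_one {a u : ℂ} (ha : ‖a‖ < 1) (hu : ‖u‖ < 1) :
    ‖diskInvolution a u‖ < 1 := by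
  have h0 : 0 < ‖1 - conj a * u‖ := norm_pos_iff.2 (one_sub_conj_mul_ne_zero ha hu.le)
  have h := one_sub_norm_diskInvolution_sq ha hu.le
  have h1 : 0 < (1 - ‖a‖ ^ 2) * (1 - ‖u‖ ^ 2) / ‖1 - conj a * u‖ ^ 2 := by
    have := norm_nonneg a
    have := norm_nonneg u
    have : 0 < 1 - ‖a‖ ^ 2 := by nlinarith
    have : 0 < 1 - ‖u‖ ^ 2 := by nlinarith
    positivity
  nlinarith [norm_nonneg (diskInvolution a u)]

lemma diskInvolution_diskInvolution {a u : ℂ} (ha : ‖a‖ < 1) (hu : ‖u‖ < 1) :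
    diskInvolution a (diskInvolution a u) = u := by
  have h1 := one_sub_conj_mul_ne_zero ha hu.le
  have h2 := one_sub_conj_mul_ne_zero ha (norm_diskInvolution_lt_one ha hu).le
  have h3 : 1 - conj a * a ≠ 0 := one_sub_conj_mul_ne_zero ha ha.le
  have h4 : a - diskInvolution a u = u * (1 - conj a * a) / (1 - conj a * u) := by
    rw [diskInvolution, eq_div_iff h1, sub_mul, div_mul_cancel₀ _ h1]
    ring
  have h5 : 1 - conj a * diskInvolution a u = (1 - conj a * a) / (1 - conj a * u) := by
    rw [diskInvolution, eq_div_iff h1, sub_mul, mul_assoc, div_mul_cancel₀ _ h1]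
    ring
  rw [diskInvolution, h4, h5, div_div_div_cancel_right₀ h1, mul_div_cancel_right₀ _ h3]

lemma differentiableOn_diskInvolution {a : ℂ} (ha : ‖a‖ < 1) :
    DifferentiableOn ℂ (diskInvolution a) (ball 0 1) := by
  intro u hu
  have h := one_sub_conj_mul_ne_zero ha (mem_ball_zero_iff.1 hu).le
  unfold diskInvolution
  exact DifferentiableAt.differentiableWithinAt (by fun_prop (disch := assumption))

/-- A holomorphic self-map of the unit disk with relatively compact image contracts
the pseudo-hyperbolic distance to a fixed point. -/
lemma exists_norm_diskInvolution_le {T : ℂ → ℂ} {r : ℝ} (hr : r < 1)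
    (hT : DifferentiableOn ℂ T (ball 0 1)) (hmaps : MapsTo T (ball 0 1) (closedBall 0 r))
    {a : ℂ} (ha : a ∈ ball (0 : ℂ) 1) (hfix : T a = a) :
    ∃ ρ < 1, ∀ z ∈ ball (0 : ℂ) 1, ‖diskInvolution a (T z)‖ ≤ ρ * ‖diskInvolution a z‖ := by
  have ha1 := mem_ball_zero_iff.1 ha
  have hr0 : 0 ≤ r := (norm_nonneg _).trans (mem_closedBall_zero_iff.1 (hmaps ha))
  -- The 4 bounds `‖1 - conj a * u‖ ^ 2` from above.
  set δ : ℝ := (1 - ‖a‖ ^ 2) * (1 - r ^ 2) / 4 with hδ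
  have hδ0 : 0 < δ := by
    have := norm_nonneg a
    have : 0 < 1 - ‖a‖ ^ 2 := by nlinarith
    have : 0 < 1 - r ^ 2 := by nlinarith
    positivity
  have hbound : ∀ u : ℂ, ‖u‖ ≤ r → ‖diskInvolution a u‖ ≤ √(1 - δ) := by
    intro u hu
    apply Real.le_sqrt_of_sq_le
    have h := one_sub_norm_diskInvolution_sq ha1 (hu.trans hr.le)
    have h0 : 0 < ‖1 - conj a * u‖ :=
      norm_pos_iff.2 (one_sub_conj_mul_ne_zero ha1 (hu.trans hr.le))
    have h2 : ‖1 - conj a * u‖ ≤ 2 := by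
      refine (norm_sub_le _ _).trans ?_
      rw [norm_one, norm_mul, Complex.norm_conj]
      nlinarith [norm_nonneg a, norm_nonneg u]
    have h3 : δ ≤ (1 - ‖a‖ ^ 2) * (1 - ‖u‖ ^ 2) / ‖1 - conj a * u‖ ^ 2 := by
      rw [hδ]
      have := norm_nonneg a
      have := norm_nonneg u
      have : 0 ≤ 1 - ‖a‖ ^ 2 := by nlinarith
      have : 0 ≤ 1 - r ^ 2 := by nlinarith
      have : 1 - r ^ 2 ≤ 1 - ‖u‖ ^ 2 := by nlinarith
      have : 0 ≤ 1 - ‖u‖ ^ 2 := by linarith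
      gcongr
      nlinarith
    linarith
  refine ⟨√(1 - δ), by rw [Real.sqrt_lt' one_pos]; linarith, fun z hz => ?_⟩
  have hmφ : ∀ u ∈ ball (0 : ℂ) 1, diskInvolution a u ∈ ball (0 : ℂ) 1 := fun u hu =>
    mem_ball_zero_iff.2 (norm_diskInvolution_lt_one ha1 (mem_ball_zero_iff.1 hu))
  have hmT : MapsTo T (ball 0 1) (ball 0 1) := fun u hu =>
    mem_ball_zero_iff.2 ((mem_closedBall_zero_iff.1 (hmaps hu)).trans_lt hr)
  have hφ := differentiableOn_diskInvolution ha1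
  -- Conjugation moves the fixed point to 0, where the Schwarz lemma applies with image radius `√(1
  -- - δ)`.
  set S : ℂ → ℂ := diskInvolution a ∘ T ∘ diskInvolution a with hS
  have hSd : DifferentiableOn ℂ S (ball 0 1) :=
    hφ.comp (hT.comp hφ hmφ) (hmT.comp hmφ)
  have hS0 : S 0 = 0 := by simp [hS, diskInvolution, hfix]
  have hSm : MapsTo S (ball 0 1) (closedBall (S 0) (√(1 - δ))) := by
    intro u hu
    rw [hS0, mem_closedBall_zero_iff]
    exact hbound _ (mem_closedBall_zero_iff.1 (hmaps (hmφ u hu)))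
  have h := dist_le_div_mul_dist_of_mapsTo_ball hSd hSm (hmφ z hz)
  rw [hS0, dist_zero_right, dist_zero_right, div_one] at h
  simpa [hS, diskInvolution_diskInvolution ha1 (mem_ball_zero_iff.1 hz)] using h

lemma eq_of_fixedPoints {T : ℂ → ℂ} {r : ℝ} (hr : r < 1)
    (hT : DifferentiableOn ℂ T (ball 0 1)) (hmaps : MapsTo T (ball 0 1) (closedBall 0 r))
    {a b : ℂ} (ha : a ∈ ball (0 : ℂ) 1) (hfa : T a = a) (hb : b ∈ ball (0 : ℂ) 1)
    (hfb : T b = b) : b = a := by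
  obtain ⟨ρ, hρ, h⟩ := exists_norm_diskInvolution_le hr hT hmaps ha hfa
  have h1 := h b hb
  rw [hfb] at h1
  have h2 : diskInvolution a b = 0 := by
    rw [← norm_eq_zero]
    nlinarith [norm_nonneg (diskInvolution a b)]
  rw [diskInvolution, div_eq_zero_iff] at h2
  have h3 := h2.resolve_right
    (one_sub_conj_mul_ne_zero (mem_ball_zero_iff.1 ha) (mem_ball_zero_iff.1 hb).le)
  exact (sub_eq_zero.1 h3).symm

/-- Dividing the contraction estimate by `‖a - z‖` and letting `z → a` gives `‖deriv T a‖ ≤ ρ < 1`.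
-/
lemma deriv_ne_one_of_fixedPoint {T : ℂ → ℂ} {r : ℝ} (hr : r < 1)
    (hT : DifferentiableOn ℂ T (ball 0 1)) (hmaps : MapsTo T (ball 0 1) (closedBall 0 r))
    {a : ℂ} (ha : a ∈ ball (0 : ℂ) 1) (hfix : T a = a) : deriv T a ≠ 1 := by
  obtain ⟨ρ, hρ, h⟩ := exists_norm_diskInvolution_le hr hT hmaps ha hfix
  have ha1 := mem_ball_zero_iff.1 ha
  have hda : DifferentiableAt ℂ T a := hT.differentiableAt (isOpen_ball.mem_nhds ha)
  have hne := one_sub_conj_mul_ne_zero ha1 ha1.le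
  have hlim1 : Tendsto (fun z => ‖slope T a z‖) (𝓝[≠] a) (𝓝 ‖deriv T a‖) :=
    (hasDerivAt_iff_tendsto_slope.1 hda.hasDerivAt).norm
  have hTt : Tendsto T (𝓝[≠] a) (𝓝 a) := by
    have := hda.continuousAt.tendsto
    rw [hfix] at this
    exact this.mono_left nhdsWithin_le_nhds
  have hid : Tendsto (fun z : ℂ => z) (𝓝[≠] a) (𝓝 a) := nhdsWithin_le_nhds
  have hlim2 : Tendsto (fun z => ρ * (‖1 - conj a * T z‖ / ‖1 - conj a * z‖)) (𝓝[≠] a) (𝓝 ρ) := by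
    have h1 := ((hTt.const_mul (conj a)).const_sub 1).norm
    have h2 := ((hid.const_mul (conj a)).const_sub 1).norm
    have h3 := (h1.div h2 (norm_ne_zero_iff.2 hne)).const_mul ρ
    rwa [div_self (norm_ne_zero_iff.2 hne), mul_one] at h3
  have hle : ‖deriv T a‖ ≤ ρ := by
    refine le_of_tendsto_of_tendsto hlim1 hlim2 ?_
    filter_upwards [self_mem_nhdsWithin,
      mem_nhdsWithin_of_mem_nhds (isOpen_ball.mem_nhds ha)] with z hza hz
    have hz1 := mem_ball_zero_iff.1 hz
    have hTz := (mem_closedBall_zero_iff.1 (hmaps hz)).trans hr.le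
    have hp1 : 0 < ‖1 - conj a * T z‖ := norm_pos_iff.2 (one_sub_conj_mul_ne_zero ha1 hTz)
    have hp2 : 0 < ‖1 - conj a * z‖ := norm_pos_iff.2 (one_sub_conj_mul_ne_zero ha1 hz1.le)
    have hp3 : 0 < ‖a - z‖ := norm_pos_iff.2 (sub_ne_zero.2 (Ne.symm hza))
    have h1 := h z hz
    rw [diskInvolution, diskInvolution, norm_div, norm_div, div_le_iff₀ hp1] at h1
    rw [slope_def_field, hfix, norm_div, norm_sub_rev, norm_sub_rev z, div_le_iff₀ hp3]
    calc _ ≤ _ := h1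
      _ = _ := by field_simp
  intro h1
  rw [h1, norm_one] at hle
  linarith

/-! ### Blaschke factors and products in the variable `F`. -/

/-- Division of a function bounded by one by a Blaschke factor in the variable `F`. -/
lemma exists_eq_sub_mul_of_apply_eq_zero {Ω : Set ℂ} (hΩ : IsOpen Ω) {F : ℂ → ℂ}
    (hF : DifferentiableOn ℂ F Ω) (hF1 : ∀ z ∈ Ω, ‖F z‖ < 1)
    (hproper : ∀ ρ < 1, IsCompact {z | z ∈ Ω ∧ ‖F z‖ ≤ ρ})
    (huniv : ∀ a ∈ Ω, ∀ z ∈ Ω, dslope F a z ≠ 0)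
    {f : ℂ → ℂ} (hf : DifferentiableOn ℂ f Ω) (hf1 : ∀ z ∈ Ω, ‖f z‖ ≤ 1)
    {a : ℂ} (ha : a ∈ Ω) (hfa : f a = 0) :
    ∃ g u : ℂ → ℂ, DifferentiableOn ℂ g Ω ∧ (∀ z ∈ Ω, ‖g z‖ ≤ 1) ∧
      DifferentiableOn ℂ u Ω ∧ (∀ z ∈ Ω, u z ≠ 0) ∧
      (∀ z ∈ Ω, (z - a) * u z = (F z - F a) / (1 - conj (F a) * F z)) ∧
      ∀ z ∈ Ω, f z = (z - a) * (u z * g z) := by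
  have hnhds : Ω ∈ 𝓝 a := hΩ.mem_nhds ha
  have hdF : DifferentiableOn ℂ (dslope F a) Ω := (differentiableOn_dslope hnhds).2 hF
  have hdf : DifferentiableOn ℂ (dslope f a) Ω := (differentiableOn_dslope hnhds).2 hf
  have hden : ∀ z ∈ Ω, 1 - conj (F a) * F z ≠ 0 := fun z hz =>
    one_sub_conj_mul_ne_zero (hF1 a ha) (hF1 z hz).le
  have hdend : DifferentiableOn ℂ (fun z => 1 - conj (F a) * F z) Ω :=
    (hF.const_mul _).const_sub 1
  set u : ℂ → ℂ := fun z => dslope F a z / (1 - conj (F a) * F z) with hu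
  set g : ℂ → ℂ := fun z => dslope f a z / u z with hg
  have hud : DifferentiableOn ℂ u Ω := hdF.div hdend hden
  have hu0 : ∀ z ∈ Ω, u z ≠ 0 := fun z hz => div_ne_zero (huniv a ha z hz) (hden z hz)
  have hgd : DifferentiableOn ℂ g Ω := hdf.div hud hu0
  have hB : ∀ z ∈ Ω, (z - a) * u z = (F z - F a) / (1 - conj (F a) * F z) := by
    intro z hz
    have := sub_smul_dslope F a z
    rw [smul_eq_mul] at this
    rw [hu, ← this, mul_div_assoc]
  have hfac : ∀ z ∈ Ω, f z = (z - a) * (u z * g z) := by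
    intro z hz
    have := sub_smul_dslope f a z
    rw [smul_eq_mul, hfa, sub_zero] at this
    rw [hg, mul_div_cancel₀ _ (hu0 z hz), this]
  refine ⟨g, u, hgd, ?_, hud, hu0, hB, hfac⟩
  intro z₀ hz₀
  -- On the level set `‖F z‖ = ρ` the Blaschke factor `β` satisfies `1 - β² ≤ K (1 - ρ²)`. The
  -- maximum principle on `{‖F‖ < ρ}` bounds `g`, and then `ρ → 1`.
  set K : ℝ := (1 - ‖F a‖ ^ 2) / (1 - ‖F a‖) ^ 2 with hK
  have hFa := hF1 a ha
  have hK0 : 0 < K := by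
    have := norm_nonneg (F a)
    have : 0 < 1 - ‖F a‖ ^ 2 := by nlinarith
    have : 0 < 1 - ‖F a‖ := by linarith
    positivity
  have hlim : Tendsto (fun ρ : ℝ => (1 - K * (1 - ρ ^ 2))⁻¹) (𝓝[<] 1) (𝓝 1) := by
    have hc : ContinuousAt (fun ρ : ℝ => (1 - K * (1 - ρ ^ 2))⁻¹) 1 :=
      ContinuousAt.inv₀ (by fun_prop) (by norm_num)
    have := hc.tendsto
    norm_num at this
    exact this.mono_left nhdsWithin_le_nhds
  have hev : ∀ᶠ ρ : ℝ in 𝓝[<] 1, 0 < 1 - K * (1 - ρ ^ 2) := by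
    have hc : ContinuousAt (fun ρ : ℝ => 1 - K * (1 - ρ ^ 2)) 1 := by fun_prop
    exact nhdsWithin_le_nhds (hc.eventually (lt_mem_nhds (by norm_num)))
  have hev2 : ∀ᶠ ρ : ℝ in 𝓝[<] 1, ‖F z₀‖ < ρ :=
    nhdsWithin_le_nhds (lt_mem_nhds (hF1 z₀ hz₀))
  refine ge_of_tendsto hlim ?_
  filter_upwards [hev, hev2, self_mem_nhdsWithin] with ρ hρ hzρ hρ1
  have hρ0 : 0 ≤ ρ := (norm_nonneg _).trans hzρ.le
  have hρ1 : ρ < 1 := hρ1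
  set U : Set ℂ := {z | z ∈ Ω ∧ ‖F z‖ < ρ} with hU
  set C : Set ℂ := {z | z ∈ Ω ∧ ‖F z‖ ≤ ρ} with hC
  have hUo : IsOpen U := hF.continuousOn.norm.isOpen_inter_preimage hΩ isOpen_Iio
  have hUC : closure U ⊆ C :=
    closure_minimal (fun z hz => ⟨hz.1, hz.2.le⟩) (hproper ρ hρ1).isClosed
  have hUb : Bornology.IsBounded U := (hproper ρ hρ1).isBounded.subset (subset_closure.trans hUC)
  refine norm_le_of_forall_mem_frontier_norm_le hUb
    (hgd.mono (hUC.trans fun z hz => hz.1)).diffContOnCl ?_ (subset_closure ⟨hz₀, hzρ⟩)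
  intro z hz
  rw [hUo.frontier_eq] at hz
  have hzΩ : z ∈ Ω := (hUC hz.1).1
  have hFz : ‖F z‖ = ρ := le_antisymm (hUC hz.1).2 (not_lt.1 fun h => hz.2 ⟨hzΩ, h⟩)
  have hfz := hf1 z hzΩ
  rw [hfac z hzΩ, ← mul_assoc, hB z hzΩ, norm_mul] at hfz
  have hinv : ‖(F z - F a) / (1 - conj (F a) * F z)‖ = ‖diskInvolution (F a) (F z)‖ := by
    rw [diskInvolution, norm_div, norm_div, norm_sub_rev]
  rw [hinv] at hfz
  have h1 := one_sub_norm_diskInvolution_sq hFa (hF1 z hzΩ).le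
  have h2 : (1 - ‖F a‖ ^ 2) * (1 - ‖F z‖ ^ 2) / ‖1 - conj (F a) * F z‖ ^ 2
      ≤ K * (1 - ρ ^ 2) := by
    have h3 := one_sub_norm_le_norm_one_sub_conj_mul (a := F a) (hF1 z hzΩ).le
    have h4 : 0 < 1 - ‖F a‖ := by linarith
    have : 0 ≤ 1 - ‖F a‖ ^ 2 := by nlinarith [norm_nonneg (F a)]
    have : 0 ≤ 1 - ρ ^ 2 := by nlinarith
    rw [hK, hFz, div_mul_eq_mul_div]
    gcongr
  set β := ‖diskInvolution (F a) (F z)‖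
  have hβ : 1 - K * (1 - ρ ^ 2) ≤ β ^ 2 := by linarith
  have hgz := norm_nonneg (g z)
  have hK1 : 1 - K * (1 - ρ ^ 2) ≤ 1 := by nlinarith [mul_nonneg hK0.le (by nlinarith : 0 ≤ 1 - ρ ^ 2)]
  rw [← one_div, le_div_iff₀ hρ]
  have hβ0 : 0 ≤ β := norm_nonneg _
  have hle : 1 - K * (1 - ρ ^ 2) ≤ β := by
    by_cases hb : β ≤ 1
    · nlinarith
    · linarith
  nlinarith

/-- A Blaschke-type inequality on a domain `Ω` mapped properly and injectively into the disk
by `F`. -/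
lemma norm_apply_zero_le_prod {Ω : Set ℂ} (hΩ : IsOpen Ω) {F : ℂ → ℂ}
    (hF : DifferentiableOn ℂ F Ω) (hF1 : ∀ z ∈ Ω, ‖F z‖ < 1)
    (hproper : ∀ ρ < 1, IsCompact {z | z ∈ Ω ∧ ‖F z‖ ≤ ρ})
    (huniv : ∀ a ∈ Ω, ∀ z ∈ Ω, dslope F a z ≠ 0) (h0 : (0 : ℂ) ∈ Ω) (hF0 : F 0 = 0)
    (M : Multiset ℂ) (hM : ∀ a ∈ M, a ∈ Ω) {f : ℂ → ℂ} (hf : DifferentiableOn ℂ f Ω)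
    (hf1 : ∀ z ∈ Ω, ‖f z‖ ≤ 1) (hord : ∀ a, (M.count a : ℕ∞) ≤ analyticOrderAt f a) :
    ‖f 0‖ ≤ (M.map fun a => ‖F a‖).prod := by
  induction M using Multiset.induction_on generalizing f with
  | empty => simpa using hf1 0 h0
  | cons a M ih =>
    have ha : a ∈ Ω := hM a (Multiset.mem_cons_self a M)
    have hfa : f a = 0 := by
      have h := hord a
      rw [Multiset.count_cons_self] at h
      apply apply_eq_zero_of_analyticOrderAt_ne_zero
      rintro h1
      rw [h1] at h
      simp at h
    obtain ⟨g, u, hgd, hg1, hud, hu0, hB, hfac⟩ :=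
      exists_eq_sub_mul_of_apply_eq_zero hΩ hF hF1 hproper huniv hf hf1 ha hfa
    have hg := ih (fun b hb => hM b (Multiset.mem_cons_of_mem hb)) hgd hg1 (by
      intro b
      by_cases hb : b ∈ M
      · have hbΩ := hM b (Multiset.mem_cons_of_mem hb)
        have hbn : Ω ∈ 𝓝 b := hΩ.mem_nhds hbΩ
        have hua := hud.analyticAt hbn
        have hga := hgd.analyticAt hbn
        have hcongr : f =ᶠ[𝓝 b] (fun z => z - a) * (u * g) :=
          eventually_of_mem hbn fun z hz => hfac z hz
        have h := hord b
        -- As `u` has no zeros, passing from `f` to `g` lowers the order by one at `a` and leaves it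
        -- unchanged elsewhere.
        rw [analyticOrderAt_congr hcongr, analyticOrderAt_mul (by fun_prop) (hua.mul hga),
          analyticOrderAt_mul hua hga, hua.analyticOrderAt_eq_zero.2 (hu0 b hbΩ), zero_add] at h
        by_cases hba : b = a
        · subst hba
          rw [analyticOrderAt_id_sub_const_self, Multiset.count_cons_self, Nat.cast_add,
            Nat.cast_one, add_comm] at h
          exact (ENat.add_le_add_iff_left ENat.one_ne_top).1 h
        · rwa [analyticOrderAt_id_sub_const_of_ne hba, zero_add,
            Multiset.count_cons_of_ne hba] at h
      · simp [Multiset.count_eq_zero_of_notMem hb])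
    have h0f : ‖f 0‖ = ‖F a‖ * ‖g 0‖ := by
      rw [hfac 0 h0, ← mul_assoc, hB 0 h0, hF0]
      simp
    rw [h0f, Multiset.map_cons, Multiset.prod_cons]
    gcongr

/-! ### The barrier map and its domain. -/

lemma re_add_div_sub {ζ : ℂ} (hζ : ‖ζ‖ = 1) (z : ℂ) :
    ((ζ + z) / (ζ - z)).re = (1 - ‖z‖ ^ 2) / ‖ζ - z‖ ^ 2 := by
  have h1 : ζ.re * ζ.re + ζ.im * ζ.im = 1 := by
    rw [← normSq_apply, normSq_eq_norm_sq, hζ, one_pow]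
  rw [div_re, ← add_div, ← normSq_eq_norm_sq, ← normSq_eq_norm_sq]
  congr 1
  simp only [normSq_apply, add_re, add_im, sub_re, sub_im]
  linear_combination h1

/-- The map `z ↦ z exp (s ∑ (ζ + z) / (ζ - z))`. The set where it is smaller than one is the unit
disk with small neighbourhoods of the points of `E` removed, and there it is a Riemann map. -/
noncomputable def barrierMap (E : Finset ℂ) (s : ℝ) (z : ℂ) : ℂ :=
  z * exp (s * ∑ ζ ∈ E, (ζ + z) / (ζ - z))

lemma norm_barrierMap {E : Finset ℂ} (hE : ∀ ζ ∈ E, ‖ζ‖ = 1) (s : ℝ) (z : ℂ) :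
    ‖barrierMap E s z‖ =
      ‖z‖ * Real.exp (s * ∑ ζ ∈ E, (1 - ‖z‖ ^ 2) / ‖ζ - z‖ ^ 2) := by
  rw [barrierMap, norm_mul, norm_exp, re_ofReal_mul, re_sum]
  congr 3
  exact Finset.sum_congr rfl fun ζ hζ => by rw [re_add_div_sub (hE ζ hζ)]

lemma sub_ne_zero_of_mem_ball {ζ z : ℂ} (hζ : ‖ζ‖ = 1) (hz : z ∈ ball (0 : ℂ) 1) :
    ζ - z ≠ 0 := by
  rw [sub_ne_zero]
  rintro rfl
  exact (mem_ball_zero_iff.1 hz).ne hζ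

lemma differentiableAt_sum_add_div_sub {E : Finset ℂ} {z : ℂ} (h : ∀ ζ ∈ E, ζ - z ≠ 0) :
    DifferentiableAt ℂ (fun z => ∑ ζ ∈ E, (ζ + z) / (ζ - z)) z := by
  refine DifferentiableAt.fun_sum fun ζ hζ => ?_
  have := h ζ hζ
  fun_prop (disch := assumption)

lemma differentiableAt_barrierMap {E : Finset ℂ} (s : ℝ) {z : ℂ} (h : ∀ ζ ∈ E, ζ - z ≠ 0) :
    DifferentiableAt ℂ (barrierMap E s) z :=
  differentiableAt_id.mul ((differentiableAt_sum_add_div_sub h).const_mul _).cexp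

/-- The part of the unit disk where `barrierMap E s` is smaller than one. -/
def barrierDomain (E : Finset ℂ) (s : ℝ) : Set ℂ :=
  {z | z ∈ ball (0 : ℂ) 1 ∧ ‖barrierMap E s z‖ < 1}

lemma differentiableOn_barrierMap {E : Finset ℂ} (hE : ∀ ζ ∈ E, ‖ζ‖ = 1) (s : ℝ) :
    DifferentiableOn ℂ (barrierMap E s) (ball 0 1) := fun _ hz =>
  (differentiableAt_barrierMap s fun ζ hζ =>
    sub_ne_zero_of_mem_ball (hE ζ hζ) hz).differentiableWithinAt

lemma isOpen_barrierDomain {E : Finset ℂ} (hE : ∀ ζ ∈ E, ‖ζ‖ = 1) (s : ℝ) :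
    IsOpen (barrierDomain E s) :=
  (differentiableOn_barrierMap hE s).continuousOn.norm.isOpen_inter_preimage isOpen_ball isOpen_Iio

/-- Solutions of `F z = w` are fixed points of `T = w exp(-s h)`, which sends the disk into radius
`‖w‖ < 1` because `Re h ≥ 0`. Uniqueness of the fixed point settles `z ≠ a`; `T' ≠ 1` settles `z =
a`. -/
lemma dslope_barrierMap_ne_zero {E : Finset ℂ} (hE : ∀ ζ ∈ E, ‖ζ‖ = 1) {s : ℝ} (hs : 0 ≤ s)
    {a z : ℂ} (ha : a ∈ barrierDomain E s) (hz : z ∈ barrierDomain E s) :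
    dslope (barrierMap E s) a z ≠ 0 := by
  set w := barrierMap E s a with hw
  set h : ℂ → ℂ := fun z => ∑ ζ ∈ E, (ζ + z) / (ζ - z) with hh
  set T : ℂ → ℂ := fun z => w * exp (-(s * h z)) with hT
  have hhd : ∀ x ∈ ball (0 : ℂ) 1, DifferentiableAt ℂ h x := fun x hx =>
    differentiableAt_sum_add_div_sub fun ζ hζ => sub_ne_zero_of_mem_ball (hE ζ hζ) hx
  have hTd : DifferentiableOn ℂ T (ball 0 1) := fun x hx =>
    (((hhd x hx).const_mul _).neg.cexp.const_mul _).differentiableWithinAt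
  have hTm : MapsTo T (ball 0 1) (closedBall 0 ‖w‖) := by
    intro x hx
    have hx1 := mem_ball_zero_iff.1 hx
    rw [mem_closedBall_zero_iff, hT, norm_mul, norm_exp, neg_re, re_ofReal_mul, hh, re_sum]
    refine mul_le_of_le_one_right (norm_nonneg _) (Real.exp_le_one_iff.2 (neg_nonpos.2 ?_))
    refine mul_nonneg hs (Finset.sum_nonneg fun ζ hζ => ?_)
    rw [re_add_div_sub (hE ζ hζ)]
    have : 0 ≤ 1 - ‖x‖ ^ 2 := by nlinarith [norm_nonneg x]
    positivity
  have hTfix : ∀ x, barrierMap E s x = w → T x = x := by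
    intro x hx
    rw [hT]
    simp only
    rw [← hx, barrierMap, mul_assoc, ← Complex.exp_add, add_neg_cancel, Complex.exp_zero, mul_one]
  by_cases hza : z = a
  · subst hza
    rw [dslope_same]
    have hd := (hhd z hz.1).hasDerivAt
    have hF : HasDerivAt (barrierMap E s) _ z :=
      (hasDerivAt_id z).mul ((hd.const_mul (s : ℂ)).cexp)
    have hTz : HasDerivAt T _ z := ((hd.const_mul (s : ℂ)).neg.cexp).const_mul w
    have hne := deriv_ne_one_of_fixedPoint hz.2 hTd hTm hz.1 (hTfix z rfl)
    have hfix := hTfix z rfl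
    rw [hTz.deriv, ← mul_assoc] at hne
    replace hne : w * exp (-(s * h z)) * -(s * deriv h z) ≠ 1 := hne
    change w * exp (-(s * h z)) = z at hfix
    rw [hfix] at hne
    rw [hF.deriv]
    -- This is `F' = exp(s h) (1 - T')` at the fixed point.
    have : (1 : ℂ) * exp (s * h z) + id z * (exp (s * h z) * (s * deriv h z)) =
        exp (s * h z) * (1 - z * -(s * deriv h z)) := by
      simp only [id]
      ring
    rw [this]
    exact mul_ne_zero (Complex.exp_ne_zero _) (sub_ne_zero.2 (Ne.symm hne))
  · rw [dslope_of_ne _ hza, slope_def_field]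
    refine div_ne_zero (sub_ne_zero.2 fun heq => hza ?_) (sub_ne_zero.2 hza)
    exact eq_of_fixedPoints ha.2 hTd hTm ha.1 (hTfix a rfl) hz.1 (hTfix z heq)

/-- Closer than `δ` to `ζ`, the single Poisson term at `ζ` gives `‖F z‖ ≥ x exp(2 (1 - x)) ≥ x (3 -
2x) ≥ 1` with `x = ‖z‖ ∈ [1/2, 1)`. -/
lemma le_norm_sub_of_mem_barrierDomain {E : Finset ℂ} (hE : ∀ ζ ∈ E, ‖ζ‖ = 1) {s δ : ℝ}
    (hδ : 0 < δ) (hδ1 : δ ≤ 1 / 2) (hs : 2 * δ ^ 2 ≤ s) {z : ℂ} (hz : z ∈ barrierDomain E s)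
    {ζ : ℂ} (hζ : ζ ∈ E) : δ ≤ ‖ζ - z‖ := by
  by_contra! hlt
  have hz1 := mem_ball_zero_iff.1 hz.1
  have h0 : 0 < ‖ζ - z‖ := norm_pos_iff.2 (sub_ne_zero_of_mem_ball (hE ζ hζ) hz.1)
  have hhalf : 1 / 2 ≤ ‖z‖ := by
    have := norm_sub_norm_le ζ z
    rw [hE ζ hζ] at this
    linarith
  have hpos : 0 ≤ 1 - ‖z‖ ^ 2 := by nlinarith
  have h1 : 2 * (1 - ‖z‖) ≤ s * ∑ ζ ∈ E, (1 - ‖z‖ ^ 2) / ‖ζ - z‖ ^ 2 := by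
    calc 2 * (1 - ‖z‖) ≤ 2 * (1 - ‖z‖ ^ 2) := by nlinarith
      _ = (2 * δ ^ 2) * ((1 - ‖z‖ ^ 2) / δ ^ 2) := by field_simp
      _ ≤ s * ((1 - ‖z‖ ^ 2) / ‖ζ - z‖ ^ 2) := by
        gcongr
        exact (by positivity : 0 ≤ 2 * δ ^ 2).trans hs
      _ ≤ s * ∑ ζ ∈ E, (1 - ‖z‖ ^ 2) / ‖ζ - z‖ ^ 2 := by
        refine mul_le_mul_of_nonneg_left ?_ ((by positivity : 0 ≤ 2 * δ ^ 2).trans hs)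
        exact Finset.single_le_sum (f := fun ζ => (1 - ‖z‖ ^ 2) / ‖ζ - z‖ ^ 2)
          (fun _ _ => by positivity) hζ
  have h2 := hz.2
  rw [norm_barrierMap hE] at h2
  have h3 := Real.add_one_le_exp (2 * (1 - ‖z‖))
  have h4 := Real.exp_le_exp.2 h1
  nlinarith

/-- Away from `E` the map is continuous up to the circle, where it has modulus `1 > ρ`; so the
sublevel set cannot reach the boundary. -/
lemma isCompact_barrierDomain_inter {E : Finset ℂ} (hE : ∀ ζ ∈ E, ‖ζ‖ = 1) {s δ : ℝ}
    (hδ : 0 < δ) (hδ1 : δ ≤ 1 / 2) (hs : 2 * δ ^ 2 ≤ s) {ρ : ℝ} (hρ : ρ < 1) :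
    IsCompact {z | z ∈ barrierDomain E s ∧ ‖barrierMap E s z‖ ≤ ρ} := by
  set K : Set ℂ := closedBall (0 : ℂ) 1 ∩ {z | ∀ ζ ∈ E, δ ≤ ‖ζ - z‖} with hK
  have hKc : IsCompact K := by
    refine (isCompact_closedBall 0 1).inter_right ?_
    simp only [Set.ofPred_forall]
    exact isClosed_iInter fun ζ => isClosed_iInter fun _ =>
      isClosed_le continuous_const (by fun_prop)
  have hcont : ContinuousOn (barrierMap E s) K := fun z hz =>
    (differentiableAt_barrierMap s fun ζ hζ =>
      norm_pos_iff.1 (hδ.trans_le (hz.2 ζ hζ))).continuousAt.continuousWithinAt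
  have heq : {z | z ∈ barrierDomain E s ∧ ‖barrierMap E s z‖ ≤ ρ} =
      K ∩ (fun z => ‖barrierMap E s z‖) ⁻¹' Iic ρ := by
    ext z
    constructor
    · rintro ⟨hz, hzρ⟩
      exact ⟨⟨ball_subset_closedBall hz.1, fun ζ hζ =>
        le_norm_sub_of_mem_barrierDomain hE hδ hδ1 hs hz hζ⟩, hzρ⟩
    · rintro ⟨⟨hz, -⟩, hzρ⟩
      have hzρ : ‖barrierMap E s z‖ ≤ ρ := hzρ
      have hz1 := mem_closedBall_zero_iff.1 hz
      refine ⟨⟨mem_ball_zero_iff.2 (hz1.lt_of_ne fun h => ?_), hzρ.trans_lt hρ⟩, hzρ⟩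
      rw [norm_barrierMap hE, h] at hzρ
      simp at hzρ
      linarith
  rw [heq]
  exact hKc.of_isClosed_subset
    (hcont.norm.preimage_isClosed_of_isClosed hKc.isClosed isClosed_Iic) inter_subset_left

/-- The Poisson sum costs at most half of the decay in `‖z‖ ≤ exp(-(1 - ‖z‖))`. -/
lemma norm_barrierMap_le {E : Finset ℂ} (hE : ∀ ζ ∈ E, ‖ζ‖ = 1) {s t : ℝ} (hs0 : 0 ≤ s)
    (ht : 0 < t) (hs : s * E.card ≤ t ^ 2 / 4) {z : ℂ} (hz : z ∈ ball (0 : ℂ) 1)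
    (hzt : ∀ ζ ∈ E, t ≤ ‖ζ - z‖) :
    ‖barrierMap E s z‖ ≤ Real.exp (-((1 - ‖z‖) / 2)) := by
  have hz1 := mem_ball_zero_iff.1 hz
  have h0 := norm_nonneg z
  have hpos : 0 ≤ 1 - ‖z‖ ^ 2 := by nlinarith
  have h1 : s * ∑ ζ ∈ E, (1 - ‖z‖ ^ 2) / ‖ζ - z‖ ^ 2 ≤ (1 - ‖z‖) / 2 := by
    calc s * ∑ ζ ∈ E, (1 - ‖z‖ ^ 2) / ‖ζ - z‖ ^ 2
        ≤ s * ∑ ζ ∈ E, (1 - ‖z‖ ^ 2) / t ^ 2 := by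
          gcongr with ζ hζ
          exact hzt ζ hζ
      _ = (s * E.card) * ((1 - ‖z‖ ^ 2) / t ^ 2) := by
          rw [Finset.sum_const, nsmul_eq_mul]
          ring
      _ ≤ (t ^ 2 / 4) * ((1 - ‖z‖ ^ 2) / t ^ 2) := by gcongr
      _ = (1 - ‖z‖ ^ 2) / 4 := by field_simp
      _ ≤ (1 - ‖z‖) / 2 := by nlinarith
  have h2 : ‖z‖ ≤ Real.exp (-(1 - ‖z‖)) := by
    have := Real.add_one_le_exp (-(1 - ‖z‖))
    linarith
  rw [norm_barrierMap hE]
  calc _ ≤ Real.exp (-(1 - ‖z‖)) * Real.exp ((1 - ‖z‖) / 2) := by gcongr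
    _ = _ := by
      rw [← Real.exp_add]
      congr 1
      ring

/-! ### The analytic majorant of `dist(z, E)^(-γ)`. -/

lemma cos_mul_rpow_le_re_cpow {u : ℂ} (hu : 0 < u.re) {γ : ℝ} (hγ0 : 0 ≤ γ) (hγ1 : γ ≤ 1) :
    Real.cos (γ * (Real.pi / 2)) * ‖u‖ ^ (-γ) ≤ (u ^ ((-γ : ℝ) : ℂ)).re := by
  rw [cpow_ofReal_re, mul_comm]
  gcongr
  rw [← Real.cos_abs (u.arg * -γ), abs_mul, abs_neg, abs_of_nonneg hγ0]
  have harg : |u.arg| ≤ Real.pi / 2 := abs_arg_le_pi_div_two_iff.2 hu.le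
  have hpi := Real.pi_pos
  refine Real.cos_le_cos_of_nonneg_of_le_pi (by positivity) (by nlinarith) ?_
  rw [mul_comm]
  gcongr

lemma norm_one_sub_mul_conj {ζ : ℂ} (hζ : ‖ζ‖ = 1) (z : ℂ) : ‖1 - z * conj ζ‖ = ‖ζ - z‖ := by
  have h : (1 : ℂ) = ζ * conj ζ := by simp [mul_conj, normSq_eq_norm_sq, hζ]
  rw [h, ← sub_mul, norm_mul, Complex.norm_conj, hζ, mul_one]

lemma re_one_sub_mul_conj_pos {ζ z : ℂ} (hζ : ‖ζ‖ = 1) (hz : z ∈ ball (0 : ℂ) 1) :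
    0 < (1 - z * conj ζ).re := by
  have h1 := re_le_norm (z * conj ζ)
  rw [norm_mul, Complex.norm_conj, hζ, mul_one] at h1
  rw [sub_re, one_re]
  linarith [mem_ball_zero_iff.1 hz]

/-- An analytic majorant: the real part of `∑ (1 - z ζ̄)^(-γ)` dominates `dist(z, E)^(-γ)`. -/
lemma cos_mul_infDist_rpow_le_re_sum {E : Finset ℂ} (hE : ∀ ζ ∈ E, ‖ζ‖ = 1) (hne : E.Nonempty)
    {γ : ℝ} (hγ0 : 0 ≤ γ) (hγ1 : γ ≤ 1) {z : ℂ} (hz : z ∈ ball (0 : ℂ) 1) :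
    Real.cos (γ * (Real.pi / 2)) * infDist z E ^ (-γ) ≤
      (∑ ζ ∈ E, (1 - z * conj ζ) ^ ((-γ : ℝ) : ℂ)).re := by
  obtain ⟨ζ₀, hζ₀, hd⟩ := E.finite_toSet.isCompact.exists_infDist_eq_dist
    (Finset.coe_nonempty.2 hne) z
  have hcos : 0 ≤ Real.cos (γ * (Real.pi / 2)) :=
    Real.cos_nonneg_of_neg_pi_div_two_le_of_le (by nlinarith [Real.pi_pos])
      (by nlinarith [Real.pi_pos])
  have hterm : ∀ ζ ∈ E, Real.cos (γ * (Real.pi / 2)) * ‖ζ - z‖ ^ (-γ) ≤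
      ((1 - z * conj ζ) ^ ((-γ : ℝ) : ℂ)).re := by
    intro ζ hζ
    rw [← norm_one_sub_mul_conj (hE ζ hζ)]
    exact cos_mul_rpow_le_re_cpow (re_one_sub_mul_conj_pos (hE ζ hζ) hz) hγ0 hγ1
  rw [re_sum, hd, dist_comm, dist_eq_norm]
  refine (hterm ζ₀ hζ₀).trans ?_
  refine Finset.single_le_sum (f := fun ζ => ((1 - z * conj ζ) ^ ((-γ : ℝ) : ℂ)).re)
    (fun ζ hζ => ?_) hζ₀
  exact (mul_nonneg hcos (by positivity)).trans (hterm ζ hζ)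

lemma differentiableOn_sum_cpow {E : Finset ℂ} (hE : ∀ ζ ∈ E, ‖ζ‖ = 1) (c : ℂ) :
    DifferentiableOn ℂ (fun z => ∑ ζ ∈ E, (1 - z * conj ζ) ^ c) (ball 0 1) := by
  refine DifferentiableOn.fun_sum fun ζ hζ z hz => ?_
  have : 1 - z * conj ζ ∈ slitPlane := Or.inl (re_one_sub_mul_conj_pos (hE ζ hζ) hz)
  refine DifferentiableAt.differentiableWithinAt ?_
  exact DifferentiableAt.cpow_const (by fun_prop) this

lemma infDist_zero_eq_one {E : Finset ℂ} (hE : ∀ ζ ∈ E, ‖ζ‖ = 1) (hne : E.Nonempty) :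
    infDist (0 : ℂ) E = 1 := by
  obtain ⟨ζ₀, hζ₀, hd⟩ := E.finite_toSet.isCompact.exists_infDist_eq_dist
    (Finset.coe_nonempty.2 hne) 0
  rw [hd, dist_zero_left, hE ζ₀ hζ₀]

/-! ### Zeros far from `E`. -/

/-- The zeros at distance at least `t` from `E`. -/
lemma exists_sum_far_zeros_le {E : Finset ℂ} (hE : ∀ ζ ∈ E, ‖ζ‖ = 1) (hne : E.Nonempty)
    {q γ : ℝ} (hγ0 : 0 ≤ γ) (hγ1 : γ < 1) (hγq : γ ≤ q) :
    ∃ C : ℝ, 0 < C ∧ ∀ (D : ℝ) (f : ℂ → ℂ), AnalyticOnNhd ℂ f (ball 0 1) → ‖f 0‖ = 1 → 0 ≤ D →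
      (∀ z ∈ ball (0 : ℂ) 1, ‖f z‖ ≤ Real.exp (D / infDist z E ^ q)) →
      ∀ t : ℝ, 0 < t → t ≤ 1 → ∀ S : Finset ℂ, (∀ a ∈ S, a ∈ ball (0 : ℂ) 1 ∧ t ≤ infDist a E) →
        ∑ a ∈ S, (analyticOrderNatAt f a : ℝ) * (1 - ‖a‖) ≤ C * D * t ^ (γ - q) := by
  have hN : (1 : ℝ) ≤ E.card := by exact_mod_cast hne.card_pos
  set N : ℝ := (E.card : ℝ) with hNdef
  -- Chosen so that `δ = κ t` and `s = t² / (4N)` satisfy `2 δ² = s` exactly.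
  set κ : ℝ := 1 / √(8 * N) with hκ
  have hκ0 : 0 < κ := by positivity
  have hκ2 : κ ^ 2 = 1 / (8 * N) := by
    rw [hκ, div_pow, Real.sq_sqrt (by positivity), one_pow]
  have hκ1 : κ ≤ 1 / 2 := by
    have : κ ^ 2 ≤ (1 / 2) ^ 2 := by
      rw [hκ2, div_pow, one_pow]
      gcongr
      linarith
    exact le_of_sq_le_sq this (by norm_num)
  set c : ℝ := Real.cos (γ * (Real.pi / 2)) with hc
  have hc0 : 0 < c := Real.cos_pos_of_mem_Ioo
    ⟨by nlinarith [Real.pi_pos], by nlinarith [Real.pi_pos]⟩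
  refine ⟨2 * N * (κ ^ (γ - q) / c), by positivity, ?_⟩
  intro D f hf hf0 hD hbound t ht ht1 S hS
  set δ : ℝ := κ * t with hδ
  set s : ℝ := t ^ 2 / (4 * N) with hs
  have hδ0 : 0 < δ := by positivity
  have hs0 : 0 ≤ s := by positivity
  have hδ1 : δ ≤ 1 / 2 := by nlinarith
  have hδs : 2 * δ ^ 2 ≤ s := by
    rw [hδ, mul_pow, hκ2, hs]
    apply le_of_eq
    field_simp
    norm_num
  have hsN : s * E.card ≤ t ^ 2 / 4 := by
    rw [← hNdef, hs]
    apply le_of_eq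
    field_simp
  have hinf : ∀ z, ∀ ζ ∈ E, infDist z E ≤ ‖ζ - z‖ := fun z ζ hζ => by
    rw [← dist_eq_norm, dist_comm]
    exact infDist_le_dist_of_mem (Finset.mem_coe.2 hζ)
  have hsmall : ∀ a ∈ S, ‖barrierMap E s a‖ ≤ Real.exp (-((1 - ‖a‖) / 2)) := fun a ha =>
    norm_barrierMap_le hE hs0 ht hsN (hS a ha).1 fun ζ hζ => (hS a ha).2.trans (hinf a ζ hζ)
  have hSΩ : ∀ a ∈ S, a ∈ barrierDomain E s := fun a ha =>
    ⟨(hS a ha).1, (hsmall a ha).trans_lt (Real.exp_lt_one_iff.2 (by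
      have := mem_ball_zero_iff.1 (hS a ha).1
      linarith))⟩
  have hΩball : barrierDomain E s ⊆ ball 0 1 := fun z hz => hz.1
  -- On the domain `dist ≥ δ` and `γ ≤ q`, so `dist^(-q) ≤ δ^(γ - q) dist^(-γ) ≤ A Re H`.
  set A : ℝ := δ ^ (γ - q) / c with hA
  set H : ℂ → ℂ := fun z => ∑ ζ ∈ E, (1 - z * conj ζ) ^ ((-γ : ℝ) : ℂ) with hH
  have hHd : DifferentiableOn ℂ H (ball 0 1) := differentiableOn_sum_cpow hE _
  set e : ℂ → ℂ := fun z => exp (-((D * A : ℝ) * H z)) with he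
  have hed : DifferentiableOn ℂ e (ball 0 1) := (hHd.const_mul _).neg.cexp
  have hfd : DifferentiableOn ℂ (f * e) (barrierDomain E s) :=
    (hf.differentiableOn.mul hed).mono hΩball
  have hnorm_e : ∀ z, ‖e z‖ = Real.exp (-(D * A * (H z).re)) := fun z => by
    rw [he, norm_exp, neg_re, re_ofReal_mul]
  have hfe1 : ∀ z ∈ barrierDomain E s, ‖(f * e) z‖ ≤ 1 := by
    intro z hz
    obtain ⟨ζ₀, hζ₀, hd⟩ := E.finite_toSet.isCompact.exists_infDist_eq_dist
      (Finset.coe_nonempty.2 hne) z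
    have hdist : δ ≤ infDist z E := by
      rw [hd, dist_comm, dist_eq_norm]
      exact le_norm_sub_of_mem_barrierDomain hE hδ0 hδ1 hδs hz hζ₀
    have hd0 : 0 < infDist z E := hδ0.trans_le hdist
    have h1 := cos_mul_infDist_rpow_le_re_sum hE hne hγ0 hγ1.le hz.1
    have h2 : (infDist z E ^ q)⁻¹ ≤ A * (H z).re := by
      calc (infDist z E ^ q)⁻¹ = infDist z E ^ (γ - q) * infDist z E ^ (-γ) := by
            rw [← Real.rpow_add hd0, ← Real.rpow_neg hd0.le]
            congr 1
            ring
        _ ≤ δ ^ (γ - q) * infDist z E ^ (-γ) := by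
            gcongr ?_ * _
            exact Real.rpow_le_rpow_of_nonpos hδ0 hdist (by linarith)
        _ = A * (c * infDist z E ^ (-γ)) := by
            rw [hA]
            field_simp
        _ ≤ A * (H z).re := by gcongr
    rw [Pi.mul_apply, norm_mul, hnorm_e]
    calc _ ≤ Real.exp (D / infDist z E ^ q) * Real.exp (-(D * A * (H z).re)) := by
          gcongr
          exact hbound z hz.1
      _ ≤ 1 := by
          rw [← Real.exp_add, Real.exp_le_one_iff, div_eq_mul_inv]
          nlinarith [mul_le_mul_of_nonneg_left h2 hD]
  set M : Multiset ℂ := ∑ a ∈ S, Multiset.replicate (analyticOrderNatAt f a) a with hM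
  have hMS : ∀ a ∈ M, a ∈ S := by
    intro a ha
    obtain ⟨b, hb, hab⟩ := Multiset.mem_sum.1 ha
    rwa [Multiset.eq_of_mem_replicate hab]
  have hF0 : barrierMap E s 0 = 0 := by simp [barrierMap]
  have h0Ω : (0 : ℂ) ∈ barrierDomain E s := ⟨by simp, by simp [hF0]⟩
  have hord : ∀ a, (M.count a : ℕ∞) ≤ analyticOrderAt (f * e) a := by
    intro a
    by_cases ha : a ∈ S
    · have hcount : M.count a = analyticOrderNatAt f a := by
        rw [hM, Multiset.count_sum']
        simp [Multiset.count_replicate, ha]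
      have han : ball (0 : ℂ) 1 ∈ 𝓝 a := isOpen_ball.mem_nhds (hS a ha).1
      rw [hcount, analyticOrderAt_mul (hf a (hS a ha).1) (hed.analyticAt han)]
      -- An infinite order is read as 0, so no finiteness is needed here.
      exact (ENat.natCast_toNat_le_self _).trans le_self_add
    · rw [Multiset.count_eq_zero_of_notMem fun h => ha (hMS a h)]
      simp
  have hmain := norm_apply_zero_le_prod (isOpen_barrierDomain hE s)
    ((differentiableOn_barrierMap hE s).mono hΩball) (fun z hz => hz.2)
    (fun ρ hρ => isCompact_barrierDomain_inter hE hδ0 hδ1 hδs hρ)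
    (fun a ha z hz => dslope_barrierMap_ne_zero hE hs0 ha hz) h0Ω hF0 M
    (fun a ha => hSΩ a (hMS a ha)) hfd hfe1 hord
  have hH0 : (H 0).re = N := by simp [hH, hNdef]
  rw [Pi.mul_apply, norm_mul, hf0, one_mul, hnorm_e, hH0] at hmain
  have hprod : (M.map fun a => ‖barrierMap E s a‖).prod ≤
      Real.exp (-∑ a ∈ S, (analyticOrderNatAt f a : ℝ) * ((1 - ‖a‖) / 2)) := by
    have h1 : (M.map fun a => ‖barrierMap E s a‖).prod =
        ∏ a ∈ S, ‖barrierMap E s a‖ ^ analyticOrderNatAt f a := by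
      rw [hM, ← Multiset.coe_mapAddMonoidHom, map_sum, Multiset.prod_sum]
      simp
    rw [h1, ← Finset.sum_neg_distrib, Real.exp_sum]
    refine Finset.prod_le_prod (fun _ _ => by positivity) fun a ha => ?_
    rw [← mul_neg, Real.exp_nat_mul]
    gcongr
    exact hsmall a ha
  have hfin := Real.exp_le_exp.1 (hmain.trans hprod)
  have hsum : ∑ a ∈ S, (analyticOrderNatAt f a : ℝ) * ((1 - ‖a‖) / 2) =
      (∑ a ∈ S, (analyticOrderNatAt f a : ℝ) * (1 - ‖a‖)) / 2 := by
    rw [Finset.sum_div]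
    exact Finset.sum_congr rfl fun a _ => by ring
  have hAt : A = κ ^ (γ - q) / c * t ^ (γ - q) := by
    rw [hA, hδ, Real.mul_rpow hκ0.le ht.le]
    ring
  rw [hsum, hAt] at hfin
  nlinarith

/-! ### Dyadic summation and conclusion. -/

/-- Summation by dyadic layers: a bound `K t^(-s)` for the mass where `d ≥ t` gives a bound for
the integral of `d^p` when `p > s`. -/
lemma sum_mul_rpow_le {ι : Type*} (S : Finset ι) (m d : ι → ℝ) (hm : ∀ i ∈ S, 0 ≤ m i)
    (hd0 : ∀ i ∈ S, 0 < d i) (hd2 : ∀ i ∈ S, d i ≤ 2) {K s p : ℝ} (hK : 0 ≤ K) (hp : 0 ≤ p)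
    (hsp : s < p)
    (h : ∀ t : ℝ, 0 < t → t ≤ 1 → ∑ i ∈ S with t ≤ d i, m i ≤ K * t ^ (-s)) :
    ∑ i ∈ S, m i * d i ^ p ≤ 2 ^ p * (1 - (1 / 2 : ℝ) ^ (p - s))⁻¹ * K := by
  have hx0 : (0 : ℝ) ≤ (1 / 2) ^ (p - s) := by positivity
  have hx1 : (1 / 2 : ℝ) ^ (p - s) < 1 :=
    Real.rpow_lt_one (by norm_num) (by norm_num) (by linarith)
  have hlevel : ∀ i ∈ S, ∃ k : ℕ, (1 / 2 : ℝ) ^ k ≤ d i ∧ d i ≤ 2 * (1 / 2) ^ k := by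
    intro i hi
    have hex : ∃ k : ℕ, (1 / 2 : ℝ) ^ k ≤ d i :=
      (exists_pow_lt_of_lt_one (hd0 i hi) (by norm_num)).imp fun _ h => h.le
    classical
    refine ⟨Nat.find hex, Nat.find_spec hex, ?_⟩
    -- At level 0 the upper bound is the hypothesis `d i ≤ 2`; otherwise it is minimality of the
    -- level.
    rcases Nat.eq_zero_or_pos (Nat.find hex) with h0 | h0
    · rw [h0]
      simpa using hd2 i hi
    · obtain ⟨k, hk⟩ := Nat.exists_eq_succ_of_ne_zero h0.ne'
      have := Nat.find_min hex (m := k) (by omega)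
      rw [hk, Nat.succ_eq_add_one, pow_succ]
      linarith
  choose! k hk1 hk2 using hlevel
  set n := S.sup k + 1 with hn
  have hterm : ∀ i ∈ S, m i * d i ^ p ≤
      ∑ j ∈ Finset.range n, if (1 / 2 : ℝ) ^ j ≤ d i then 2 ^ p * ((1 / 2 : ℝ) ^ j) ^ p * m i
        else 0 := by
    intro i hi
    have hmi := hm i hi
    have hdi := hd0 i hi
    have hki : k i ∈ Finset.range n := by
      rw [Finset.mem_range, hn]
      exact Nat.lt_succ_of_le (Finset.le_sup hi)
    refine le_trans ?_ (Finset.single_le_sum (fun j _ => ?_) hki)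
    · rw [if_pos (hk1 i hi), ← Real.mul_rpow (by norm_num) (by positivity), mul_comm]
      gcongr
      exact hk2 i hi
    · split_ifs <;> positivity
  calc ∑ i ∈ S, m i * d i ^ p
      ≤ ∑ i ∈ S, ∑ j ∈ Finset.range n,
          if (1 / 2 : ℝ) ^ j ≤ d i then 2 ^ p * ((1 / 2 : ℝ) ^ j) ^ p * m i else 0 :=
        Finset.sum_le_sum hterm
    _ = ∑ j ∈ Finset.range n, 2 ^ p * ((1 / 2 : ℝ) ^ j) ^ p *
          ∑ i ∈ S with (1 / 2 : ℝ) ^ j ≤ d i, m i := by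
        rw [Finset.sum_comm]
        refine Finset.sum_congr rfl fun j _ => ?_
        rw [Finset.mul_sum, Finset.sum_filter]
    _ ≤ ∑ j ∈ Finset.range n, 2 ^ p * ((1 / 2 : ℝ) ^ j) ^ p * (K * ((1 / 2 : ℝ) ^ j) ^ (-s)) := by
        gcongr with j
        exact h _ (by positivity) (pow_le_one₀ (by norm_num) (by norm_num))
    _ = 2 ^ p * K * ∑ j ∈ Finset.range n, ((1 / 2 : ℝ) ^ (p - s)) ^ j := by
        rw [Finset.mul_sum]
        refine Finset.sum_congr rfl fun j _ => ?_
        have : ((1 / 2 : ℝ) ^ (p - s)) ^ j = ((1 / 2 : ℝ) ^ j) ^ p * ((1 / 2 : ℝ) ^ j) ^ (-s) := by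
          rw [← Real.rpow_add (by positivity), ← sub_eq_add_neg, ← Real.rpow_natCast,
            ← Real.rpow_natCast, ← Real.rpow_mul (by norm_num), ← Real.rpow_mul (by norm_num),
            mul_comm]
        rw [this]
        ring
    _ ≤ 2 ^ p * K * (1 - (1 / 2 : ℝ) ^ (p - s))⁻¹ := by
        gcongr
        rw [← tsum_geometric_of_lt_one hx0 hx1]
        exact (summable_geometric_of_lt_one hx0 hx1).sum_le_tsum _ fun _ _ => by positivity
    _ = _ := by ring

/-- The weighted Blaschke bound for finite sets of points. -/
lemma exists_sum_zeros_le {E : Finset ℂ} (hE : ∀ ζ ∈ E, ‖ζ‖ = 1) (hne : E.Nonempty)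
    {q ε : ℝ} (hq : 0 ≤ q) (hε : 0 < ε) :
    ∃ C : ℝ, 0 < C ∧ ∀ (D : ℝ) (f : ℂ → ℂ), AnalyticOnNhd ℂ f (ball 0 1) → ‖f 0‖ = 1 → 0 ≤ D →
      (∀ z ∈ ball (0 : ℂ) 1, ‖f z‖ ≤ Real.exp (D / infDist z E ^ q)) →
      ∀ S : Finset ℂ, (∀ a ∈ S, a ∈ ball (0 : ℂ) 1) →
        ∑ a ∈ S, (analyticOrderNatAt f a : ℝ) *
          ((1 - ‖a‖) * infDist a E ^ max (q - 1 + ε) 0) ≤ C * D := by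
  set p : ℝ := max (q - 1 + ε) 0 with hp
  have hp0 : 0 ≤ p := le_max_right _ _
  have hd0 : ∀ a ∈ ball (0 : ℂ) 1, 0 < infDist a E := by
    intro a ha
    refine (E.finite_toSet.isClosed.notMem_iff_infDist_pos (Finset.coe_nonempty.2 hne)).1 ?_
    exact fun h => (mem_ball_zero_iff.1 ha).ne (hE a (Finset.mem_coe.1 h))
  have hd2 : ∀ a ∈ ball (0 : ℂ) 1, infDist a E ≤ 2 := by
    intro a ha
    obtain ⟨ζ, hζ⟩ := hne
    refine (infDist_le_dist_of_mem (Finset.mem_coe.2 hζ)).trans ?_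
    rw [dist_eq_norm]
    have := norm_sub_le a ζ
    linarith [mem_ball_zero_iff.1 ha, hE ζ hζ]
  have hm0 : ∀ (f : ℂ → ℂ), ∀ a ∈ ball (0 : ℂ) 1,
      0 ≤ (analyticOrderNatAt f a : ℝ) * (1 - ‖a‖) := fun f a ha =>
    mul_nonneg (Nat.cast_nonneg _) (by linarith [mem_ball_zero_iff.1 ha])
  rcases lt_or_ge q 1 with hq1 | hq1
  -- With `γ = q` the bound does not depend on `t`, so one `t` below all distances in `S` suffices.
  · obtain ⟨C, hC, h⟩ := exists_sum_far_zeros_le hE hne hq hq1 le_rfl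
    refine ⟨C * 2 ^ p, by positivity, fun D f hf hf0 hD hb S hS => ?_⟩
    rcases S.eq_empty_or_nonempty with rfl | hSne
    · simpa using mul_nonneg (by positivity : 0 ≤ C * 2 ^ p) hD
    obtain ⟨b, hbS, hbmin⟩ := S.exists_min_image (fun a => infDist a E) hSne
    have h1 := h D f hf hf0 hD hb (min 1 (infDist b E)) (lt_min one_pos (hd0 b (hS b hbS)))
      (min_le_left _ _) S fun a ha => ⟨hS a ha, (min_le_right _ _).trans (hbmin a ha)⟩
    rw [sub_self, Real.rpow_zero, mul_one] at h1
    calc ∑ a ∈ S, (analyticOrderNatAt f a : ℝ) * ((1 - ‖a‖) * infDist a E ^ p)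
        ≤ ∑ a ∈ S, (analyticOrderNatAt f a : ℝ) * (1 - ‖a‖) * 2 ^ p := by
          refine Finset.sum_le_sum fun a ha => ?_
          rw [← mul_assoc]
          exact mul_le_mul_of_nonneg_left
            (Real.rpow_le_rpow infDist_nonneg (hd2 a (hS a ha)) hp0) (hm0 f a (hS a ha))
      _ = (∑ a ∈ S, (analyticOrderNatAt f a : ℝ) * (1 - ‖a‖)) * 2 ^ p := by rw [Finset.sum_mul]
      _ ≤ C * D * 2 ^ p := by gcongr
      _ = C * 2 ^ p * D := by ring
  -- With `γ = 1 - η` the mass grows like `t^(-(q - 1 + η))`; `η < ε` makes the dyadic series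
  -- converge, and `η > 0` keeps the cosine positive.
  · set η : ℝ := min ε 1 / 2 with hη
    have hη0 : 0 < η := by
      have := lt_min hε one_pos
      positivity
    have hη1 : η ≤ 1 / 2 := by
      have := min_le_right ε 1
      rw [hη]
      linarith
    have hηε : η < ε := by
      have := min_le_left ε 1
      linarith
    obtain ⟨C, hC, h⟩ := exists_sum_far_zeros_le hE hne (q := q) (γ := 1 - η) (by linarith)
      (by linarith) (by linarith)
    have hsp : q - 1 + η < p := lt_of_lt_of_le (by linarith) (le_max_left _ _)
    have hx1 : (1 / 2 : ℝ) ^ (p - (q - 1 + η)) < 1 :=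
      Real.rpow_lt_one (by norm_num) (by norm_num) (by linarith)
    have hx2 : 0 < 1 - (1 / 2 : ℝ) ^ (p - (q - 1 + η)) := by linarith
    refine ⟨2 ^ p * (1 - (1 / 2 : ℝ) ^ (p - (q - 1 + η)))⁻¹ * C, by positivity,
      fun D f hf hf0 hD hb S hS => ?_⟩
    have h1 := sum_mul_rpow_le S (fun a => (analyticOrderNatAt f a : ℝ) * (1 - ‖a‖))
      (fun a => infDist a E) (fun a ha => hm0 f a (hS a ha)) (fun a ha => hd0 a (hS a ha))
      (fun a ha => hd2 a (hS a ha)) (mul_nonneg hC.le hD) hp0 hsp (fun t ht ht1 => by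
        have h2 := h D f hf hf0 hD hb t ht ht1 {a ∈ S | t ≤ infDist a E} fun a ha => by
          rw [Finset.mem_filter] at ha
          exact ⟨hS a ha.1, ha.2⟩
        have h3 : 1 - η - q = -(q - 1 + η) := by ring
        rwa [h3] at h2)
    simp only [mul_assoc] at h1 ⊢
    exact h1

theorem theorem1 (E : Set ℂ) (hE_fin : E.Finite) (hE_ne : E.Nonempty)
    (hE : E ⊆ Metric.sphere (0 : ℂ) 1) (q : ℝ) (hq : 0 ≤ q) (ε : ℝ) (hε : 0 < ε) :
    ∃ C : ℝ, 0 < C ∧ ∀ (D : ℝ) (f : ℂ → ℂ),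
      AnalyticOnNhd ℂ f (Metric.ball (0 : ℂ) 1) →
      ‖f 0‖ = 1 →
      (∀ z ∈ Metric.ball (0 : ℂ) 1, ‖f z‖ ≤ Real.exp (D / Metric.infDist z E ^ q)) →
      Summable (fun z : diskZeros f =>
        (analyticOrderNatAt f (z : ℂ) : ℝ) *
          ((1 - ‖(z : ℂ)‖) * Metric.infDist (z : ℂ) E ^ max (q - 1 + ε) 0)) ∧
      ∑' z : diskZeros f,
        (analyticOrderNatAt f (z : ℂ) : ℝ) *
          ((1 - ‖(z : ℂ)‖) * Metric.infDist (z : ℂ) E ^ max (q - 1 + ε) 0) ≤ C * D := by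
  lift E to Finset ℂ using hE_fin
  have hE1 : ∀ ζ ∈ E, ‖ζ‖ = 1 := fun ζ hζ => mem_sphere_zero_iff_norm.1 (hE hζ)
  have hne : E.Nonempty := Finset.coe_nonempty.1 hE_ne
  obtain ⟨C, hC, h⟩ := exists_sum_zeros_le hE1 hne hq hε
  refine ⟨C, hC, fun D f hf hf0 hb => ?_⟩
  -- The growth bound at 0, where `dist(0, E) = 1`, reads `1 ≤ exp D`.
  have hD : 0 ≤ D := by
    have h0 := hb 0 (mem_ball_self one_pos)
    rw [hf0, infDist_zero_eq_one hE1 hne, Real.one_rpow, div_one] at h0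
    exact Real.one_le_exp_iff.1 h0
  have hnonneg : ∀ z : diskZeros f, 0 ≤ (analyticOrderNatAt f (z : ℂ) : ℝ) *
      ((1 - ‖(z : ℂ)‖) * infDist (z : ℂ) E ^ max (q - 1 + ε) 0) := fun z => by
    have h1 : ‖(z : ℂ)‖ < 1 := mem_ball_zero_iff.1 z.2.1
    have h2 : 0 ≤ 1 - ‖(z : ℂ)‖ := by linarith
    have h3 : 0 ≤ infDist (z : ℂ) E := infDist_nonneg
    positivity
  have hsum : ∀ S : Finset (diskZeros f), ∑ z ∈ S, (analyticOrderNatAt f (z : ℂ) : ℝ) *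
      ((1 - ‖(z : ℂ)‖) * infDist (z : ℂ) E ^ max (q - 1 + ε) 0) ≤ C * D := fun S => by
    have h1 := h D f hf hf0 hD hb (S.map (Function.Embedding.subtype _)) fun a ha => by
      obtain ⟨z, -, rfl⟩ := Finset.mem_map.1 ha
      exact z.2.1
    rwa [Finset.sum_map] at h1
  exact ⟨summable_of_sum_le hnonneg hsum, Real.tsum_le_of_sum_le hnonneg hsum⟩
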